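/- Let $A=(a_{i,j})_{i,j=1}^n$ be a primitive $0$-$1$ matrix, and let $\mathcal O_A$ be the Cuntz–Krieger algebra, that is, the universal unital $C^*$-algebra generated by partial isometries $S_1,\dots,S_n$ with $\sum_i S_iS_i^*=1$ and $S_i^*S_i=\sum_j a_{i,j}S_jS_j^*$. For a finite word $I=i_1\cdots i_k$ put $S_I=S_{i_1}\cdots S_{i_k}$, and let $\mathcal D_A\subset\mathcal O_A$ be the $C^*$-subalgebra generated by all $S_IS_I^*$. A representation $\pi$ of $\mathcal O_A$ on a Hilbert space $\mathcal H$ is called *monic* if $\mathcal D_A$ has a cyclic vector, i.e. $\overline{\pi(\mathcal D_A)\xi}=\mathcal H$ for some $\xi\in\mathcal H$. A *semibranching function system* (s.f.s.) on a non-atomic probability space $(X,m)$ consists of measurable sets $D_1,\dots,D_n\subset X$, injective measurable maps $\sigma_i:D_i\to X$ that send measurable sets to measurable sets, with ranges $R_i=\sigma_i(D_i)$, and a measurable map $\sigma:X\to X$ (the coding map) such that (i) $m(R_i\cap R_j)=0$ for $i\ne j$ and $m(X\setminus\bigcup_iR_i)=0$; (ii) $m\circ\sigma_i\ll m$ and $\frac{d(m\circ\sigma_i)}{dm}>0$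 $m$-a.e. on $D_i$, where $(m\circ\sigma_i)(E)=m(\sigma_i(E\cap D_i))$; (iii) $\sigma(\sigma_i(x))=x$ for $m$-a.e. $x\in D_i$. It is *saturated* if $m(X\setminus\bigcup_iD_i)=0$, and it satisfies *condition (C-K)* with matrix $A$ if $D_i=\bigcup_{j:\,a_{i,j}=1}R_j$ up to $m$-null sets for every $i$. A *monic system* for the s.f.s. is a family of functions $f_i\in L^2(X,m)$, $i=1,\dots,n$, such that $m\circ\sigma_i^{-1}\ll m$, $\frac{d(m\circ\sigma_i^{-1})}{dm}=|f_i|^2$, and $f_i\neq0$ $m$-a.e. on $R_i$. A representation $\pi$ of $\mathcal O_A$ on $L^2(X,m)$ is *associated* to the monic system $(m,(f_i))$ if $\pi(S_i)g=f_i\cdot(g\circ\sigma)$ for all $g\in L^2(X,m)$ and all $i$. Let $X_A=\{x=(x_k)_{k\ge0}: x_k\in\{1,\dots,n\},\ a_{x_k,x_{k+1}}=1\ \text{for all }k\}$ be the one-sided topological Markov chain with its Borel $\sigma$-algebra, and consider on it the sets $D_i=\{x: a_{i,x_0}=1\}$, the maps $\sigma_i(x)=(i,x_0,x_1,\dots)$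 and the shift $\sigma$. An *inherent monic system* for $A$ is a Borel probability measure $\mu$ on $X_A$ for which these maps form an s.f.s. on $(X_A,\mu)$, together with a monic system $(\mu,(h_i))$ for this s.f.s. **Theorem.** Let $\pi$ be the representation of $\mathcal O_A$ on $L^2(X,m)$ associated to a monic system $(m,(f_i)_{i=1}^n)$ for a saturated s.f.s. on a non-atomic probability space $(X,m)$ that satisfies condition (C-K) with matrix $A$. Then $\pi$ is monic if and only if it is unitarily equivalent to a representation of $\mathcal O_A$ associated to an inherent monic system for $A$. -/

import Mathlib

open MeasureTheory
open scoped ENNReal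

noncomputable section

/-! ### The Cuntz-Krieger algebra of a matrix with entries `0` and `1` -/

/-- Partial isometries `s i` with `∑ i, s i (s i)* = 1` and
`(s i)* s i = ∑ j, A i j • s j (s j)*`. -/
structure IsCuntzKriegerFamily {ι B : Type*} [Fintype ι] [Ring B] [StarRing B]
    (A : Matrix ι ι ℤ) (s : ι → B) : Prop where
  partialIsometry : ∀ i, s i * star (s i) * s i = s i
  sum_range : ∑ i, s i * star (s i) = 1
  source_eq : ∀ i, star (s i) * s i = ∑ j, A i j • (s j * star (s j))

theorem IsCuntzKriegerFamily.norm_le_one {ι B : Type*} [Fintype ι] [NormedRing B] [StarRing B]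
    [CStarRing B] {A : Matrix ι ι ℤ} {s : ι → B} (h : IsCuntzKriegerFamily A s) (i : ι) :
    ‖s i‖ ≤ 1 := by
  have hp : star (star (s i) * s i) * (star (s i) * s i) = star (s i) * s i := by
    have := h.partialIsometry i
    simp only [star_mul, star_star]
    rw [mul_assoc, ← mul_assoc (s i), this]
  have h1 : ‖star (s i) * s i‖ * ‖star (s i) * s i‖ = ‖star (s i) * s i‖ := by
    rw [← CStarRing.norm_star_mul_self, hp]
  have h2 : ‖star (s i) * s i‖ = ‖s i‖ * ‖s i‖ := CStarRing.norm_star_mul_self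
  have h3 := norm_nonneg (s i)
  rw [h2] at h1
  by_contra hlt
  push Not at hlt
  have h4 : 1 < ‖s i‖ * ‖s i‖ := by nlinarith
  nlinarith

/-- The separable infinite-dimensional Hilbert space `ℓ²(ℕ)`. -/
abbrev SeqHilbert : Type := lp (fun _ : ℕ => ℂ) 2

instance : Nontrivial SeqHilbert :=
  ⟨⟨lp.single 2 (0 : ℕ) (1 : ℂ), 0, fun h => by
    have := congrArg (fun v : SeqHilbert => v 0) h
    simp at this⟩⟩

/-- All Cuntz-Krieger families for `A` on `ℓ²(ℕ)`. -/
abbrev CuntzKriegerFamilies {n : ℕ} (A : Matrix (Fin n) (Fin n) ℤ) : Type :=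
  {s : Fin n → (SeqHilbert →L[ℂ] SeqHilbert) // IsCuntzKriegerFamily A s}

/-- All bounded functions from the set of Cuntz-Krieger families on `ℓ²(ℕ)` to the bounded
operators on `ℓ²(ℕ)`. -/
abbrev CuntzKriegerBounded {n : ℕ} (A : Matrix (Fin n) (Fin n) ℤ) : Type :=
  lp (fun _ : CuntzKriegerFamilies A => (SeqHilbert →L[ℂ] SeqHilbert)) ∞

/-- The same type, regarded as a C*-algebra with pointwise operations and the supremum norm. -/
def CuntzKriegerAmbient {n : ℕ} (A : Matrix (Fin n) (Fin n) ℤ) : Type := CuntzKriegerBounded A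

/-- The C*-algebra structure. -/
def cuntzKriegerAmbientCStar {n : ℕ} (A : Matrix (Fin n) (Fin n) ℤ) :
    CStarAlgebra (CuntzKriegerBounded A) :=
  { (inferInstance : NormedRing (CuntzKriegerBounded A)),
    (inferInstance : StarRing (CuntzKriegerBounded A)),
    (inferInstance : CompleteSpace (CuntzKriegerBounded A)),
    (inferInstance : CStarRing (CuntzKriegerBounded A)),
    (inferInstance : NormedAlgebra ℂ (CuntzKriegerBounded A)),
    (inferInstance : StarModule ℂ (CuntzKriegerBounded A)) with }

instance {n : ℕ} (A : Matrix (Fin n) (Fin n) ℤ) : CStarAlgebra (CuntzKriegerAmbient A) :=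
  cuntzKriegerAmbientCStar A

/-- The element `s ↦ s i` of the ambient C*-algebra. -/
def cuntzKriegerAmbientGen {n : ℕ} (A : Matrix (Fin n) (Fin n) ℤ) (i : Fin n) :
    CuntzKriegerAmbient A :=
  ⟨fun s => s.1 i, memℓp_infty ⟨1, by
    rintro _ ⟨s, rfl⟩
    exact s.2.norm_le_one i⟩⟩

/-- The Cuntz-Krieger algebra `𝒪_A`: the universal unital C*-algebra on the Cuntz-Krieger
relations, realised as the C*-algebra generated by the tuple of all Cuntz-Krieger families on
`ℓ²(ℕ)`. The norm of a *-polynomial in the generators is thus the supremum of its norms over these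
families, which is the universal norm: the action of a family on an arbitrary Hilbert space on a
unit vector `v` only involves the separable reducing subspace generated by `v`, and a countable
multiple of the restriction to that subspace is unitarily equivalent to a family on `ℓ²(ℕ)`. -/
def cuntzKriegerSubalgebra {n : ℕ} (A : Matrix (Fin n) (Fin n) ℤ) :
    StarSubalgebra ℂ (CuntzKriegerAmbient A) :=
  (StarAlgebra.adjoin ℂ (Set.range (cuntzKriegerAmbientGen A))).topologicalClosure

/-- `𝒪_A` as a type. -/
abbrev CuntzKriegerAlgebra {n : ℕ} (A : Matrix (Fin n) (Fin n) ℤ) : Type :=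
  cuntzKriegerSubalgebra A

instance {n : ℕ} (A : Matrix (Fin n) (Fin n) ℤ) : CStarAlgebra (CuntzKriegerAlgebra A) :=
  StarSubalgebra.cstarAlgebra (cuntzKriegerSubalgebra A)
    (h_closed := StarSubalgebra.isClosed_topologicalClosure _)

namespace CuntzKriegerAlgebra

variable {n : ℕ} (A : Matrix (Fin n) (Fin n) ℤ)

/-- The canonical generator `S i` of `𝒪_A`. -/
def gen (i : Fin n) : CuntzKriegerAlgebra A :=
  ⟨cuntzKriegerAmbientGen A i,
    StarSubalgebra.le_topologicalClosure _ (StarAlgebra.subset_adjoin ℂ _ ⟨i, rfl⟩)⟩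

/-- The representation of `𝒪_A` on `ℓ²(ℕ)` given by a Cuntz-Krieger family on `ℓ²(ℕ)`. -/
def evalRep (s : CuntzKriegerFamilies A) :
    CuntzKriegerAlgebra A →⋆ₐ[ℂ] (SeqHilbert →L[ℂ] SeqHilbert) where
  toFun a := (show CuntzKriegerBounded A from a.1) s
  map_one' := rfl
  map_mul' _ _ := rfl
  map_zero' := rfl
  map_add' _ _ := rfl
  commutes' _ := rfl
  map_star' _ := rfl

theorem ext_evalRep {a b : CuntzKriegerAlgebra A} (h : ∀ s, evalRep A s a = evalRep A s b) :
    a = b :=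
  Subtype.ext (Subtype.ext (funext h))

/-- The generators of `𝒪_A` satisfy the Cuntz-Krieger relations. -/
theorem isCuntzKriegerFamily_gen : IsCuntzKriegerFamily A (gen A) where
  partialIsometry i := ext_evalRep A fun s => by
    simp only [map_mul, map_star]
    exact s.2.partialIsometry i
  sum_range := ext_evalRep A fun s => by
    simp only [map_sum, map_mul, map_star, map_one]
    exact s.2.sum_range
  source_eq i := ext_evalRep A fun s => by
    simp only [map_sum, map_mul, map_star, map_zsmul]
    exact s.2.source_eq i

/-- `S_I = S_{i₁} ⋯ S_{i_k}` for a finite word `I = i₁ ⋯ i_k`. -/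
def word (I : List (Fin n)) : CuntzKriegerAlgebra A := (I.map (gen A)).prod

/-- The diagonal `𝒟_A`: the C*-subalgebra of `𝒪_A` generated by all `S_I S_I*`. -/
def diagonal : StarSubalgebra ℂ (CuntzKriegerAlgebra A) :=
  (StarAlgebra.adjoin ℂ
    (Set.range fun I : List (Fin n) => word A I * star (word A I))).topologicalClosure

end CuntzKriegerAlgebra

/-- A representation of `𝒪_A` is monic if `𝒟_A` has a cyclic vector. -/
def IsMonicRep {n : ℕ} {A : Matrix (Fin n) (Fin n) ℤ} {H : Type*} [NormedAddCommGroup H]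
    [InnerProductSpace ℂ H] [CompleteSpace H]
    (π : CuntzKriegerAlgebra A →⋆ₐ[ℂ] (H →L[ℂ] H)) : Prop :=
  ∃ ξ : H, Dense {v : H | ∃ a ∈ CuntzKriegerAlgebra.diagonal A, v = π a ξ}

/-- Unitary equivalence of representations of `𝒪_A`. -/
def UnitarilyEquivalentReps {n : ℕ} {A : Matrix (Fin n) (Fin n) ℤ} {H K : Type*}
    [NormedAddCommGroup H] [InnerProductSpace ℂ H] [CompleteSpace H]
    [NormedAddCommGroup K] [InnerProductSpace ℂ K] [CompleteSpace K]
    (π : CuntzKriegerAlgebra A →⋆ₐ[ℂ] (H →L[ℂ] H))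
    (ρ : CuntzKriegerAlgebra A →⋆ₐ[ℂ] (K →L[ℂ] K)) : Prop :=
  ∃ U : H ≃ₗᵢ[ℂ] K, ∀ a v, U (π a v) = ρ a (U v)

/-! ### Semibranching function systems and monic systems -/

/-- Every measurable set of positive measure has a measurable subset of strictly smaller positive
measure. (On a standard Borel space: points are null.) -/
def IsNonatomic {X : Type*} [MeasurableSpace X] (m : Measure X) : Prop :=
  ∀ s, MeasurableSet s → 0 < m s → ∃ t, t ⊆ s ∧ MeasurableSet t ∧ 0 < m t ∧ m t < m s

/-- Partially defined maps `σ_i : D_i → X`, and a map `σ : X → X`. -/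
structure BranchingMaps (ι X : Type*) where
  dom : ι → Set X
  branch : ∀ i, dom i → X
  coding : X → X

namespace BranchingMaps

variable {ι X : Type*} (F : BranchingMaps ι X)

/-- `R_i = σ_i(D_i)`. -/
def ran (i : ι) : Set X := Set.range (F.branch i)

variable [MeasurableSpace X]

/-- The measure `m ∘ σ_i`, that is `E ↦ m (σ_i (E ∩ D_i))`. -/
def compBranch (m : Measure X) (i : ι) : Measure X :=
  (m.comap (F.branch i)).map Subtype.val

/-- The measure `m ∘ σ_i⁻¹`, that is `E ↦ m (σ_i⁻¹ (E))`, where `σ_i⁻¹ (E) ⊆ D_i`. -/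
def compBranchInv (m : Measure X) (i : ι) : Measure X :=
  (m.comap Subtype.val).map (F.branch i)

/-- Semibranching function system on a nonatomic probability space, with its coding map. The
condition `MeasurableEmbedding` says that `σ_i` is injective and measurable with measurable images
of measurable sets (automatic for injective measurable maps of standard Borel spaces), so that
`m ∘ σ_i` is a measure. -/
structure IsSemibranching (m : Measure X) : Prop where
  isProbabilityMeasure : IsProbabilityMeasure m
  nonatomic : IsNonatomic m
  measurableSet_dom : ∀ i, MeasurableSet (F.dom i)
  measurableEmbedding : ∀ i, MeasurableEmbedding (F.branch i)
  ran_inter : ∀ i j, i ≠ j → m (F.ran i ∩ F.ran j) = 0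
  ran_cover : m (⋃ i, F.ran i)ᶜ = 0
  absolutelyContinuous : ∀ i, F.compBranch m i ≪ m
  rnDeriv_pos : ∀ i, ∀ᵐ x ∂m, x ∈ F.dom i → 0 < (F.compBranch m i).rnDeriv m x
  measurable_coding : Measurable F.coding
  coding_branch : ∀ i, ∀ᵐ x ∂m, ∀ hx : x ∈ F.dom i, F.coding (F.branch i ⟨x, hx⟩) = x

/-- The system is saturated: the domains cover `X` up to a null set. -/
def IsSaturated (m : Measure X) : Prop := m (⋃ i, F.dom i)ᶜ = 0

/-- Condition (C-K) with matrix `A`: up to null sets, `D_i` is the union of the `R_j` with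
`A i j = 1`. -/
def SatisfiesCK (m : Measure X) (A : Matrix ι ι ℤ) : Prop :=
  ∀ i, F.dom i =ᵐ[m] ⋃ j ∈ {j | A i j = 1}, F.ran j

/-- `(m, (f_i))` is a monic system: `m ∘ σ_i⁻¹ ≪ m`, with Radon-Nikodym derivative `|f_i|²`, where
`f_i ∈ L²(m)` does not vanish almost everywhere on `R_i`. -/
structure IsMonicSystem (m : Measure X) (f : ι → X → ℂ) : Prop where
  absolutelyContinuous : ∀ i, F.compBranchInv m i ≪ m
  memLp : ∀ i, MemLp (f i) 2 m
  rnDeriv_eq : ∀ i, (F.compBranchInv m i).rnDeriv m =ᵐ[m] fun x => ENNReal.ofReal (‖f i x‖ ^ 2)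
  ne_zero : ∀ i, ∀ᵐ x ∂m, x ∈ F.ran i → f i x ≠ 0

end BranchingMaps

/-- The representation `π` of `𝒪_A` on `L²(X, m)` is the one associated to the monic system
`(m, (f_i))`: `π (S_i) g = f_i · (g ∘ σ)`. -/
def BranchingMaps.IsAssociatedRep {n : ℕ} {X : Type*} [MeasurableSpace X]
    (F : BranchingMaps (Fin n) X) (m : Measure X) (f : Fin n → X → ℂ)
    {A : Matrix (Fin n) (Fin n) ℤ}
    (π : CuntzKriegerAlgebra A →⋆ₐ[ℂ] (Lp ℂ 2 m →L[ℂ] Lp ℂ 2 m)) : Prop :=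
  ∀ (i : Fin n) (g : Lp ℂ 2 m),
    (π (CuntzKriegerAlgebra.gen A i) g : X → ℂ) =ᵐ[m] fun x => f i x * g (F.coding x)

/-! ### The topological Markov chain -/

/-- The space `X_A` of one-sided sequences `x` with `A (x k) (x (k + 1)) = 1` for all `k`. Its
`σ`-algebra, inherited from the product, is the Borel one, generated by the cylinder sets. -/
abbrev MarkovChainSpace {n : ℕ} (A : Matrix (Fin n) (Fin n) ℤ) : Type :=
  {x : ℕ → Fin n // ∀ k, A (x k) (x (k + 1)) = 1}

/-- The standard maps on `X_A`: `D_i = {x | A i (x 0) = 1}`, `σ_i(x) = i x`, and the shift. -/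
def markovBranchingMaps {n : ℕ} (A : Matrix (Fin n) (Fin n) ℤ) :
    BranchingMaps (Fin n) (MarkovChainSpace A) where
  dom i := {x | A i (x.1 0) = 1}
  branch i x := ⟨fun k => Nat.casesOn k i x.1.1, fun k => by
    cases k with
    | zero => exact x.2
    | succ k => exact x.1.2 k⟩
  coding x := ⟨fun k => x.1 (k + 1), fun k => x.2 (k + 1)⟩

/-- `(m, (f_i))` is an inherent monic system for `A`: a monic system on `X_A` for the standard
maps, which form a semibranching function system with respect to `m`. -/
def IsInherentMonicSystem {n : ℕ} (A : Matrix (Fin n) (Fin n) ℤ)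
    (m : Measure (MarkovChainSpace A)) (f : Fin n → MarkovChainSpace A → ℂ) : Prop :=
  (markovBranchingMaps A).IsSemibranching m ∧ (markovBranchingMaps A).IsMonicSystem m f

end

/-!
The implication from right to left rests on the fact that, in a representation associated to a monic
system, `S_I S_I^*` acts as multiplication by the indicator function of the set of points whose
itinerary starts with the word `I` (`IsAssociatedRep.word_mul_star_word`). On `X_A` these sets are
the cylinder sets, which generate the Borel `σ`-algebra and form a `π`-system; hence the constant
function `1` is cyclic for the diagonal (`isMonicRep_of_inherent`).

Conversely, condition (C-K) makes the itinerary of almost every point of `X` an element of `X_A`,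
which gives a measurable map `θ : X → X_A` with `θ ∘ σ = shift ∘ θ`
(`IsSemibranching.exists_isItineraryMap`). The algebra generated by the `S_I S_I^*` acts by
multiplication by functions `φ ∘ θ`, so if `ξ` is a cyclic vector of the diagonal, every `g` in
`L²(X, m)` is an almost everywhere limit of functions `(φ_k ∘ θ) · ξ`. For `g = 1` this shows that
`ξ` vanishes almost nowhere, and then that `ξ` and all other elements of `L²(X, m)` are functions of
`θ` (`IsAssociatedRep.exists_ae_eq_comp`). Thus composition with `θ` is a unitary from
`L²(X_A, θ_* m)` onto `L²(X, m)`, and `f_i = h_i ∘ θ`. The `h_i` form an inherent monic system for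
`θ_* m` because `θ` carries the measure `m ∘ σ_i⁻¹` to its analogue on `X_A`
(`IsItineraryMap.compBranchInv_map`), and the unitary carries `π` to the associated representation.
-/

/-! ### Null sets and branching maps -/

namespace BranchingMaps

variable {ι X : Type*} [MeasurableSpace X] {F : BranchingMaps ι X} {m : Measure X}

instance [IsFiniteMeasure m] (i : ι) : IsFiniteMeasure (F.compBranch m i) := by
  unfold compBranch
  infer_instance

instance [IsFiniteMeasure m] (i : ι) : IsFiniteMeasure (F.compBranchInv m i) := by
  unfold compBranchInv
  infer_instance

theorem IsSemibranching.measurableSet_ran (hF : F.IsSemibranching m) (i : ι) :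
    MeasurableSet (F.ran i) :=
  (hF.measurableEmbedding i).measurableSet_range

theorem compBranch_apply {i : ι} (he : MeasurableEmbedding (F.branch i)) {E : Set X}
    (hE : MeasurableSet E) :
    F.compBranch m i E = m (F.branch i '' (Subtype.val ⁻¹' E)) := by
  rw [compBranch, Measure.map_apply measurable_subtype_coe hE, he.comap_apply]

theorem compBranchInv_apply {i : ι} (hD : MeasurableSet (F.dom i))
    (he : MeasurableEmbedding (F.branch i)) {E : Set X} (hE : MeasurableSet E) :
    F.compBranchInv m i E = m (Subtype.val '' (F.branch i ⁻¹' E)) := by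
  rw [compBranchInv, Measure.map_apply he.measurable hE,
    (MeasurableEmbedding.subtype_coe hD).comap_apply]

/-- Since `m ∘ σ_i ≪ m`, a property of almost every `σ_i y` may be checked for almost every
`y ∈ D_i`. -/
theorem IsSemibranching.ae_ran_of_ae_dom (hF : F.IsSemibranching m) (i : ι) {p : X → Prop}
    (h : ∀ᵐ y ∂m, ∀ hy : y ∈ F.dom i, p (F.branch i ⟨y, hy⟩)) :
    ∀ᵐ x ∂m, x ∈ F.ran i → p x := by
  set N := toMeasurable m {y | ¬ ∀ hy : y ∈ F.dom i, p (F.branch i ⟨y, hy⟩)}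
  have hN : m N = 0 := by rw [measure_toMeasurable]; exact h
  have h0 := hF.absolutelyContinuous i hN
  rw [compBranch_apply (hF.measurableEmbedding i) (measurableSet_toMeasurable _ _)] at h0
  refine measure_mono_null ?_ h0
  intro x hx
  simp only [Set.mem_compl_iff, Set.mem_ofPred_eq, Classical.not_imp] at hx
  obtain ⟨⟨⟨y, hy⟩, rfl⟩, hp⟩ := hx
  exact ⟨⟨y, hy⟩, subset_toMeasurable _ _ (fun hc => hp (hc hy)), rfl⟩

/-- Since `m ∘ σ_i⁻¹ ≪ m`, a property of almost every point holds for `σ_i y`, for almost every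
`y ∈ D_i`. -/
theorem IsSemibranching.ae_dom_of_ae (hF : F.IsSemibranching m) {i : ι}
    (hac : F.compBranchInv m i ≪ m) {p : X → Prop} (h : ∀ᵐ x ∂m, p x) :
    ∀ᵐ y ∂m, ∀ hy : y ∈ F.dom i, p (F.branch i ⟨y, hy⟩) := by
  have h1 : ∀ᵐ y ∂(m.comap (Subtype.val : F.dom i → X)), p (F.branch i y) :=
    ae_of_ae_map (hF.measurableEmbedding i).measurable.aemeasurable (hac.ae_le h)
  have h2 : ∀ᵐ y ∂(m.comap (Subtype.val : F.dom i → X)),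
      ∀ hy : y.1 ∈ F.dom i, p (F.branch i ⟨y.1, hy⟩) := by
    filter_upwards [h1] with y hy _ using hy
  rw [← ae_restrict_iff_subtype (hF.measurableSet_dom i)
    (p := fun y => ∀ hy : y ∈ F.dom i, p (F.branch i ⟨y, hy⟩)),
    ae_restrict_iff' (hF.measurableSet_dom i)] at h2
  filter_upwards [h2] with y hy hy' using hy hy' hy'

/-- The coding map is also a right inverse: `σ_i (σ x) = x` for almost every `x ∈ R_i`. -/
theorem IsSemibranching.ae_branch_coding (hF : F.IsSemibranching m) (i : ι) :
    ∀ᵐ x ∂m, x ∈ F.ran i → ∃ hx : F.coding x ∈ F.dom i, F.branch i ⟨F.coding x, hx⟩ = x := by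
  refine hF.ae_ran_of_ae_dom i ?_
  filter_upwards [hF.coding_branch i] with y hy hyD
  have h := hy hyD
  exact ⟨h.symm ▸ hyD, by congr⟩

theorem IsSemibranching.ae_exists_mem_ran (hF : F.IsSemibranching m) :
    ∀ᵐ x ∂m, ∃ i, x ∈ F.ran i := by
  have h : ∀ᵐ x ∂m, x ∈ ⋃ i, F.ran i := hF.ran_cover
  simpa using h

theorem IsSemibranching.ae_ran_unique [Countable ι] (hF : F.IsSemibranching m) :
    ∀ᵐ x ∂m, ∀ i j, x ∈ F.ran i → x ∈ F.ran j → i = j := by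
  refine ae_all_iff.2 fun i => ae_all_iff.2 fun j => ?_
  by_cases hij : i = j
  · simp [hij]
  · filter_upwards [measure_eq_zero_iff_ae_notMem.1 (hF.ran_inter i j hij)] with x hx hi hj
    exact (hx ⟨hi, hj⟩).elim

theorem IsSemibranching.quasiMeasurePreserving_coding [Countable ι] (hF : F.IsSemibranching m) :
    Measure.QuasiMeasurePreserving F.coding m m := by
  refine ⟨hF.measurable_coding, Measure.AbsolutelyContinuous.mk fun N hN hN0 => ?_⟩
  rw [Measure.map_apply hF.measurable_coding hN, measure_eq_zero_iff_ae_notMem]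
  have h : ∀ i, ∀ᵐ x ∂m, x ∈ F.ran i → x ∉ F.coding ⁻¹' N := fun i => by
    refine hF.ae_ran_of_ae_dom i ?_
    filter_upwards [hF.coding_branch i, measure_eq_zero_iff_ae_notMem.1 hN0] with y hy hyN hyD
    rwa [Set.mem_preimage, hy hyD]
  filter_upwards [hF.ae_exists_mem_ran, ae_all_iff.2 h] with x ⟨i, hi⟩ hx using hx i hi

theorem IsMonicSystem.compBranchInv_eq (hF : F.IsSemibranching m) {f : ι → X → ℂ}
    (hf : F.IsMonicSystem m f) (i : ι) :
    F.compBranchInv m i = m.withDensity fun x => ENNReal.ofReal (‖f i x‖ ^ 2) := by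
  have := hF.isProbabilityMeasure
  rw [← withDensity_congr_ae (hf.rnDeriv_eq i),
    Measure.withDensity_rnDeriv_eq _ _ (hf.absolutelyContinuous i)]

theorem IsMonicSystem.ae_eq_zero_of_notMem_ran (hF : F.IsSemibranching m) {f : ι → X → ℂ}
    (hf : F.IsMonicSystem m f) (i : ι) : ∀ᵐ x ∂m, x ∉ F.ran i → f i x = 0 := by
  have hR := (hF.measurableSet_ran i).compl
  have h0 : F.compBranchInv m i (F.ran i)ᶜ = 0 := by
    rw [compBranchInv_apply (hF.measurableSet_dom i) (hF.measurableEmbedding i) hR]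
    convert measure_empty (μ := m)
    ext x
    simp [ran]
  have hae : AEMeasurable (fun x => ENNReal.ofReal (‖f i x‖ ^ 2)) m :=
    ((hf.memLp i).1.norm.aemeasurable.pow_const 2).ennreal_ofReal
  rw [hf.compBranchInv_eq hF, withDensity_apply _ hR, lintegral_eq_zero_iff' hae.restrict,
    Filter.EventuallyEq, ae_restrict_iff' hR] at h0
  filter_upwards [h0] with x hx hxR
  have := hx hxR
  simp only [Pi.zero_apply, ENNReal.ofReal_eq_zero] at this
  simpa using this

/-! ### The diagonal acts by multiplication operators -/

/-- The cylinder set of a word `i₁ ⋯ i_k`: the points `x` with `σ^{l - 1}(x) ∈ R_{i_l}` for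
`1 ≤ l ≤ k`. -/
def wordCylinder (F : BranchingMaps ι X) : List ι → Set X
  | [] => Set.univ
  | i :: I => F.ran i ∩ F.coding ⁻¹' wordCylinder F I

theorem IsSemibranching.measurableSet_wordCylinder (hF : F.IsSemibranching m) (I : List ι) :
    MeasurableSet (F.wordCylinder I) := by
  induction I with
  | nil => exact MeasurableSet.univ
  | cons i I ih => exact (hF.measurableSet_ran i).inter (hF.measurable_coding ih)

end BranchingMaps

section Representation

variable {n : ℕ} {A : Matrix (Fin n) (Fin n) ℤ} {X : Type*} [MeasurableSpace X]
  {F : BranchingMaps (Fin n) X} {m : Measure X} {f : Fin n → X → ℂ}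
  {π : CuntzKriegerAlgebra A →⋆ₐ[ℂ] (Lp ℂ 2 m →L[ℂ] Lp ℂ 2 m)}

open CuntzKriegerAlgebra BranchingMaps

/-- `S_i S_i^*` acts as multiplication by the indicator function of `R_i`: the range of `S_i` lies
in `L²(R_i)`, these subspaces are mutually orthogonal, and the operators `S_i S_i^*` sum to `1`. -/
theorem BranchingMaps.IsAssociatedRep.gen_mul_star_gen (hF : F.IsSemibranching m)
    (hf : F.IsMonicSystem m f) (hπ : F.IsAssociatedRep m f π) (i : Fin n) (g : Lp ℂ 2 m) :
    (π (gen A i * star (gen A i)) g : X → ℂ) =ᵐ[m] (F.ran i).indicator g := by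
  have hsum : g = ∑ j, π (gen A j * star (gen A j)) g := by
    have := congrArg (fun a => π a g) (isCuntzKriegerFamily_gen A).sum_range
    simpa [map_sum, -map_mul] using this.symm
  have hsum' : (g : X → ℂ) =ᵐ[m] ∑ j, (π (gen A j * star (gen A j)) g : X → ℂ) := by
    conv_lhs => rw [hsum]
    exact Lp.coeFn_finsetSum _ _
  have hsupp : ∀ j, ∀ᵐ x ∂m, x ∉ F.ran j → (π (gen A j * star (gen A j)) g : X → ℂ) x = 0 := by
    intro j
    rw [map_mul]
    filter_upwards [hπ j (π (star (gen A j)) g), hf.ae_eq_zero_of_notMem_ran hF j] with x hx hx' hxR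
    rw [mul_apply_eq_comp, hx, hx' hxR, zero_mul]
  filter_upwards [hsum', ae_all_iff.2 hsupp, hF.ae_ran_unique] with x h1 h2 h3
  by_cases hx : x ∈ F.ran i
  · rw [Set.indicator_of_mem hx, h1, Finset.sum_apply, Finset.sum_eq_single i]
    · exact fun j _ hj => h2 j fun hxj => hj (h3 j i hxj hx)
    · simp
  · rw [Set.indicator_of_notMem hx, h2 i hx]

/-- `S_I S_I^*` acts as multiplication by the indicator function of the cylinder set of `I`. -/
theorem BranchingMaps.IsAssociatedRep.word_mul_star_word (hF : F.IsSemibranching m)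
    (hf : F.IsMonicSystem m f) (hπ : F.IsAssociatedRep m f π) (I : List (Fin n)) (g : Lp ℂ 2 m) :
    (π (word A I * star (word A I)) g : X → ℂ) =ᵐ[m] (F.wordCylinder I).indicator g := by
  induction I generalizing g with
  | nil => simp [word, wordCylinder]
  | cons i I ih =>
    have hw : word A (i :: I) * star (word A (i :: I)) =
        gen A i * ((word A I * star (word A I)) * star (gen A i)) := by
      simp [word, mul_assoc]
    have h1 := hπ i (π (word A I * star (word A I)) (π (star (gen A i)) g))
    have h2 := hF.quasiMeasurePreserving_coding.ae_eq_comp (ih (π (star (gen A i)) g))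
    have h3 := hπ i (π (star (gen A i)) g)
    have h4 := hπ.gen_mul_star_gen hF hf i g
    rw [map_mul] at h4
    rw [hw, map_mul, map_mul π (word A I * star (word A I))]
    filter_upwards [h1, h2, h3, h4] with x h1 h2 h3 h4
    rw [mul_apply_eq_comp] at h4
    rw [mul_apply_eq_comp, mul_apply_eq_comp, h1]
    simp only [Function.comp_apply] at h2
    by_cases hJ : F.coding x ∈ F.wordCylinder I
    · rw [h2, Set.indicator_of_mem hJ, ← h3, h4]
      by_cases hi : x ∈ F.ran i <;> simp [wordCylinder, hJ, hi]
    · rw [h2, Set.indicator_of_notMem hJ, mul_zero, Set.indicator_of_notMem fun h => hJ h.2]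

end Representation

/-! ### Cylinder sets of the topological Markov chain -/

section MarkovChain

open BranchingMaps

variable {n : ℕ} {A : Matrix (Fin n) (Fin n) ℤ}

theorem ran_markovBranchingMaps (i : Fin n) :
    (markovBranchingMaps A).ran i = {x | x.1 0 = i} := by
  ext x
  constructor
  · rintro ⟨y, rfl⟩
    rfl
  · rintro rfl
    refine ⟨⟨(markovBranchingMaps A).coding x, x.2 0⟩, Subtype.ext (funext fun k => ?_)⟩
    cases k <;> rfl

theorem measurable_markovChain_apply (k : ℕ) :
    Measurable fun x : MarkovChainSpace A => x.1 k :=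
  (measurable_pi_apply k).comp measurable_subtype_coe

theorem measurable_markov_coding : Measurable (markovBranchingMaps A).coding :=
  (measurable_pi_lambda _ fun k => measurable_markovChain_apply (k + 1)).subtype_mk

theorem isPiSystem_wordCylinder_markov :
    IsPiSystem (Set.range (markovBranchingMaps A).wordCylinder) := by
  rintro _ ⟨I, rfl⟩ _ ⟨J, rfl⟩ hne
  induction I generalizing J with
  | nil => exact ⟨J, by simp [wordCylinder]⟩
  | cons i I ih =>
    cases J with
    | nil => exact ⟨i :: I, by simp [wordCylinder]⟩
    | cons j J =>
      obtain ⟨x, ⟨hi, hI⟩, hj, hJ⟩ := hne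
      rw [ran_markovBranchingMaps] at hi hj
      obtain rfl : i = j := hi.symm.trans hj
      obtain ⟨K, hK⟩ := ih J ⟨_, hI, hJ⟩
      exact ⟨i :: K, by rw [wordCylinder, hK, wordCylinder, wordCylinder, Set.preimage_inter,
        Set.inter_inter_distrib_left]⟩

theorem measurableSet_wordCylinder_markov (I : List (Fin n)) :
    MeasurableSet ((markovBranchingMaps A).wordCylinder I) := by
  induction I with
  | nil => exact MeasurableSet.univ
  | cons i I ih =>
    rw [wordCylinder, ran_markovBranchingMaps]
    exact (measurable_markovChain_apply 0 (MeasurableSet.singleton i)).inter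
      (measurable_markov_coding ih)

theorem generateFrom_wordCylinder_markov :
    (inferInstance : MeasurableSpace (MarkovChainSpace A)) =
      MeasurableSpace.generateFrom (Set.range (markovBranchingMaps A).wordCylinder) := by
  refine le_antisymm ?_ (MeasurableSpace.generateFrom_le (by
    rintro _ ⟨I, rfl⟩
    exact measurableSet_wordCylinder_markov I))
  set 𝒢 := MeasurableSpace.generateFrom (Set.range (markovBranchingMaps A).wordCylinder)
  -- The shift and the zeroth coordinate are measurable for `𝒢`, hence so is each coordinate.
  have hshift : Measurable[𝒢, 𝒢] (markovBranchingMaps A).coding := by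
    refine @measurable_generateFrom _ _ 𝒢 _ _ ?_
    rintro _ ⟨I, rfl⟩
    have : (markovBranchingMaps A).coding ⁻¹' (markovBranchingMaps A).wordCylinder I =
        ⋃ i, (markovBranchingMaps A).wordCylinder (i :: I) := by
      ext x
      simp [wordCylinder, ran_markovBranchingMaps]
    rw [this]
    exact MeasurableSet.iUnion fun i => MeasurableSpace.measurableSet_generateFrom ⟨_, rfl⟩
  have hzero : Measurable[𝒢] fun x : MarkovChainSpace A => x.1 0 := by
    refine @measurable_to_countable' _ _ _ _ 𝒢 _ fun i => ?_
    have : (fun x : MarkovChainSpace A => x.1 0) ⁻¹' {i} =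
        (markovBranchingMaps A).wordCylinder [i] := by
      ext x
      simp [wordCylinder, ran_markovBranchingMaps]
    rw [this]
    exact MeasurableSpace.measurableSet_generateFrom ⟨_, rfl⟩
  have hcoord : ∀ k, Measurable[𝒢] fun x : MarkovChainSpace A => x.1 k := by
    intro k
    induction k with
    | zero => exact hzero
    | succ k ih => exact ih.comp hshift
  exact measurable_iff_comap_le.1 (@measurable_pi_lambda _ _ _ 𝒢 _ _ hcoord)

end MarkovChain

/-! ### Representations associated to inherent monic systems are monic -/

section Inherent

open BranchingMaps CuntzKriegerAlgebra

variable {n : ℕ} {A : Matrix (Fin n) (Fin n) ℤ}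

/-- An integrable function on `X_A` whose integrals over all cylinder sets vanish is zero. -/
theorem ae_eq_zero_of_setIntegral_wordCylinder {μ : Measure (MarkovChainSpace A)}
    {g : MarkovChainSpace A → ℂ} (hg : Integrable g μ)
    (h : ∀ I, ∫ x in (markovBranchingMaps A).wordCylinder I, g x ∂μ = 0) : g =ᵐ[μ] 0 := by
  suffices key : ∀ s, MeasurableSet s → ∫ x in s, g x ∂μ = 0 from
    hg.ae_eq_zero_of_forall_setIntegral_eq_zero fun s hs _ => key s hs
  intro s hs
  induction s, hs using MeasurableSpace.induction_on_inter generateFrom_wordCylinder_markov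
    isPiSystem_wordCylinder_markov with
  | empty => simp
  | basic s hs =>
    obtain ⟨I, rfl⟩ := hs
    exact h I
  | compl s hs ih =>
    have h1 := integral_add_compl hs hg
    have h2 : ∫ x, g x ∂μ = 0 := by simpa [wordCylinder] using h []
    rw [ih, h2, zero_add] at h1
    exact h1
  | iUnion s hd hs ih =>
    rw [integral_iUnion hs hd hg.integrableOn]
    simp only [ih, tsum_zero]

theorem isMonicRep_of_inherent {μ : Measure (MarkovChainSpace A)}
    {h : Fin n → MarkovChainSpace A → ℂ} (hh : IsInherentMonicSystem A μ h)
    {ρ : CuntzKriegerAlgebra A →⋆ₐ[ℂ] (Lp ℂ 2 μ →L[ℂ] Lp ℂ 2 μ)}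
    (hρ : (markovBranchingMaps A).IsAssociatedRep μ h ρ) : IsMonicRep ρ := by
  have := hh.1.isProbabilityMeasure
  set ξ : Lp ℂ 2 μ := Lp.const 2 μ (1 : ℂ)
  let K : Submodule ℂ (Lp ℂ 2 μ) :=
    (Subalgebra.toSubmodule (diagonal A).toSubalgebra).map
      ((ContinuousLinearMap.apply ℂ (Lp ℂ 2 μ) ξ).toLinearMap ∘ₗ ρ.toAlgHom.toLinearMap)
  refine ⟨ξ, ?_⟩
  have hK : {v : Lp ℂ 2 μ | ∃ a ∈ diagonal A, v = ρ a ξ} = K := by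
    ext v
    exact ⟨fun ⟨a, ha, h⟩ => ⟨a, ha, h.symm⟩, fun ⟨a, ha, h⟩ => ⟨a, ha, h.symm⟩⟩
  rw [hK, Submodule.dense_iff_topologicalClosure_eq_top, Submodule.topologicalClosure_eq_top_iff,
    Submodule.eq_bot_iff]
  intro g hg
  rw [Lp.eq_zero_iff_ae_eq_zero]
  refine ae_eq_zero_of_setIntegral_wordCylinder ((Lp.memLp g).integrable one_le_two) fun I => ?_
  have hI := hh.1.measurableSet_wordCylinder I
  have hmem : indicatorConstLp 2 hI (measure_ne_top μ _) (1 : ℂ) ∈ K := by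
    refine ⟨word A I * star (word A I), StarSubalgebra.le_topologicalClosure _
      (StarAlgebra.subset_adjoin ℂ _ ⟨I, rfl⟩), Lp.ext ?_⟩
    filter_upwards [hρ.word_mul_star_word hh.1 hh.2 I ξ, Lp.coeFn_const 2 μ (1 : ℂ),
      indicatorConstLp_coeFn (hs := hI) (hμs := measure_ne_top μ _) (p := 2) (c := (1 : ℂ))]
      with x h1 h2 h3
    refine h1.trans (Eq.trans ?_ h3.symm)
    by_cases hx : x ∈ (markovBranchingMaps A).wordCylinder I
    · rw [Set.indicator_of_mem hx, Set.indicator_of_mem hx, h2, Function.const_apply]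
    · simp [hx]
  rw [← L2.inner_indicatorConstLp_one hI (measure_ne_top μ _) g]
  exact hg _ hmem

theorem IsMonicRep.of_unitarilyEquivalent {H K : Type*}
    [NormedAddCommGroup H] [InnerProductSpace ℂ H] [CompleteSpace H]
    [NormedAddCommGroup K] [InnerProductSpace ℂ K] [CompleteSpace K]
    {π : CuntzKriegerAlgebra A →⋆ₐ[ℂ] (H →L[ℂ] H)} {ρ : CuntzKriegerAlgebra A →⋆ₐ[ℂ] (K →L[ℂ] K)}
    (hρ : IsMonicRep ρ) (h : UnitarilyEquivalentReps π ρ) : IsMonicRep π := by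
  obtain ⟨U, hU⟩ := h
  obtain ⟨ξ, hξ⟩ := hρ
  refine ⟨U.symm ξ, (hξ.preimage U.toHomeomorph.isOpenMap).mono ?_⟩
  rintro v ⟨a, ha, hv⟩
  exact ⟨a, ha, U.injective (by rw [hU, U.apply_symm_apply]; exact hv)⟩

end Inherent

/-! ### Itineraries -/

namespace BranchingMaps

variable {n : ℕ} {A : Matrix (Fin n) (Fin n) ℤ} {X : Type*} [MeasurableSpace X]
  {F : BranchingMaps (Fin n) X} {m : Measure X}

/-- `θ : X → X_A` sends almost every point to its itinerary with respect to the sets `R_i`. This is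
expressed by reading off the first letter of `θ x` and by the equivariance `θ ∘ σ = shift ∘ θ`. -/
structure IsItineraryMap (F : BranchingMaps (Fin n) X) (m : Measure X)
    (θ : X → MarkovChainSpace A) : Prop where
  measurable : Measurable θ
  mem_ran_iff : ∀ᵐ x ∂m, ∀ i, x ∈ F.ran i ↔ (θ x).1 0 = i
  apply_coding : ∀ᵐ x ∂m, θ (F.coding x) = (markovBranchingMaps A).coding (θ x)

theorem IsSemibranching.exists_isItineraryMap (hF : F.IsSemibranching m)
    (hCK : F.SatisfiesCK m A) : ∃ θ : X → MarkovChainSpace A, IsItineraryMap F m θ := by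
  classical
  have := hF.isProbabilityMeasure
  obtain ⟨x₀, i₀, -⟩ := hF.ae_exists_mem_ran.exists
  have : Nonempty (Fin n) := ⟨i₀⟩
  -- The first letter `r x`, well defined outside the null sets `R_i ∩ R_j`.
  obtain ⟨r, hr, hrT⟩ := exists_measurable_piecewise
    (fun i => F.ran i \ ⋃ j ∈ {j | j ≠ i}, F.ran j)
    (fun i => (hF.measurableSet_ran i).diff
      (MeasurableSet.biUnion (Set.to_countable _) fun j _ => hF.measurableSet_ran j))
    (fun i (_ : X) => i) (fun i => measurable_const) (by
      intro i j hij x hx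
      exact (hx.1.2 (Set.mem_biUnion (x := j) (fun h => hij h.symm) hx.2.1)).elim)
  have hr_iff : ∀ᵐ x ∂m, ∀ i, x ∈ F.ran i ↔ r x = i := by
    filter_upwards [hF.ae_exists_mem_ran, hF.ae_ran_unique] with x ⟨j, hj⟩ hu
    have hrx : r x = j := hrT j ⟨hj, by
      simp only [Set.mem_iUnion, not_exists]
      exact fun k hk hxk => hk (hu k j hxk hj)⟩
    exact fun i => ⟨fun hi => hrx.trans (hu j i hj hi), fun hi => by rwa [← hi, hrx]⟩
  have hstep : ∀ᵐ x ∂m, A (r x) (r (F.coding x)) = 1 := by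
    have hσ := hF.quasiMeasurePreserving_coding
    have hCK' : ∀ᵐ x ∂m, ∀ i, x ∈ F.dom i → ∃ j, A i j = 1 ∧ x ∈ F.ran j := by
      refine ae_all_iff.2 fun i => ?_
      filter_upwards [(hCK i).mem_iff] with x hx hxi
      simpa using hx.1 hxi
    filter_upwards [hr_iff, hσ.ae hr_iff, hσ.ae hCK',
      ae_all_iff.2 fun i => hF.ae_branch_coding i] with x h1 h2 h3 h4
    obtain ⟨hx, -⟩ := h4 (r x) ((h1 (r x)).2 rfl)
    obtain ⟨j, hj, hxj⟩ := h3 _ hx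
    rwa [(h2 j).1 hxj]
  let t : X → ℕ → Fin n := fun x k => r (F.coding^[k] x)
  have ht : Measurable t :=
    measurable_pi_lambda _ fun k => hr.comp (hF.measurable_coding.iterate k)
  let G : Set X := {x | ∀ k, A (t x k) (t x (k + 1)) = 1}
  have hG : MeasurableSet G := by
    have : G = ⋂ k, t ⁻¹' {y | A (y k) (y (k + 1)) = 1} := by
      ext x
      simp [G]
    rw [this]
    refine MeasurableSet.iInter fun k => ht ?_
    have hk : Measurable fun y : ℕ → Fin n => (y k, y (k + 1)) :=
      (measurable_pi_apply k).prodMk (measurable_pi_apply (k + 1))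
    exact hk (MeasurableSet.of_discrete (s := {p : Fin n × Fin n | A p.1 p.2 = 1}))
  have hG1 : ∀ᵐ x ∂m, x ∈ G := by
    refine ae_all_iff.2 fun k => ?_
    filter_upwards [(hF.quasiMeasurePreserving_coding.iterate k).ae hstep] with x hx
    simpa [t, Function.iterate_succ_apply'] using hx
  obtain ⟨y₀, hy₀⟩ := hG1.exists
  -- Points outside the full measure set `G` are sent to the itinerary of the point `y₀` of `G`.
  refine ⟨fun x => ⟨if x ∈ G then t x else t y₀, ?_⟩, ?_, ?_, ?_⟩
  · split_ifs with h
    exacts [h, hy₀]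
  · exact (Measurable.ite hG ht measurable_const).subtype_mk
  · filter_upwards [hG1, hr_iff] with x hx h
    simpa [hx, t] using h
  · filter_upwards [hG1, hF.quasiMeasurePreserving_coding.ae hG1] with x hx hx'
    refine Subtype.ext (funext fun k => ?_)
    simp [hx, hx', t, markovBranchingMaps]

variable {θ : X → MarkovChainSpace A}

theorem IsItineraryMap.mem_dom_iff (hθ : IsItineraryMap F m θ) (hCK : F.SatisfiesCK m A)
    (i : Fin n) : ∀ᵐ x ∂m, x ∈ F.dom i ↔ θ x ∈ (markovBranchingMaps A).dom i := by
  filter_upwards [(hCK i).mem_iff, hθ.mem_ran_iff] with x h1 h2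
  rw [h1]
  simp [markovBranchingMaps, h2]

theorem IsItineraryMap.mem_wordCylinder_iff (hF : F.IsSemibranching m)
    (hθ : IsItineraryMap F m θ) (I : List (Fin n)) :
    ∀ᵐ x ∂m, x ∈ F.wordCylinder I ↔ θ x ∈ (markovBranchingMaps A).wordCylinder I := by
  induction I with
  | nil => simp [wordCylinder]
  | cons i I ih =>
    filter_upwards [hF.quasiMeasurePreserving_coding.ae ih, hθ.mem_ran_iff, hθ.apply_coding]
      with x h1 h2 h3
    rw [wordCylinder, wordCylinder, ran_markovBranchingMaps, Set.mem_inter_iff, Set.mem_inter_iff,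
      Set.mem_preimage, h1, h3, h2 i]
    rfl

/-- The itinerary map intertwines the maps `σ_i` with the standard ones. -/
theorem IsItineraryMap.apply_branch (hF : F.IsSemibranching m) (hθ : IsItineraryMap F m θ)
    (i : Fin n) (hac : F.compBranchInv m i ≪ m) :
    ∀ᵐ x ∂m, ∀ (hx : x ∈ F.dom i) (hx' : θ x ∈ (markovBranchingMaps A).dom i),
      θ (F.branch i ⟨x, hx⟩) = (markovBranchingMaps A).branch i ⟨θ x, hx'⟩ := by
  filter_upwards [hF.ae_dom_of_ae hac hθ.mem_ran_iff, hF.ae_dom_of_ae hac hθ.apply_coding,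
    hF.coding_branch i] with x h1 h2 h3 hx hx'
  have h0 := (h1 hx i).1 ⟨_, rfl⟩
  have h4 := h2 hx
  rw [h3 hx] at h4
  refine Subtype.ext (funext fun k => ?_)
  cases k with
  | zero => exact h0
  | succ k => exact (congrFun (congrArg Subtype.val h4) k).symm

end BranchingMaps

/-! ### Monic representations live on the itinerary space -/

section Factor

variable {n : ℕ} {A : Matrix (Fin n) (Fin n) ℤ} {X : Type*} [MeasurableSpace X]
  {F : BranchingMaps (Fin n) X} {m : Measure X} {f : Fin n → X → ℂ}
  {π : CuntzKriegerAlgebra A →⋆ₐ[ℂ] (Lp ℂ 2 m →L[ℂ] Lp ℂ 2 m)} {θ : X → MarkovChainSpace A}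

open CuntzKriegerAlgebra BranchingMaps Filter Topology
open scoped CStarAlgebra

/-- The *-algebra generated by the projections `S_I S_I^*` acts by multiplication by functions of
the itinerary. -/
theorem BranchingMaps.IsAssociatedRep.exists_multiplier (hF : F.IsSemibranching m)
    (hf : F.IsMonicSystem m f) (hπ : F.IsAssociatedRep m f π) (hθ : IsItineraryMap F m θ)
    {a : CuntzKriegerAlgebra A}
    (ha : a ∈ StarAlgebra.adjoin ℂ
      (Set.range fun I : List (Fin n) => word A I * star (word A I))) :
    ∃ φ : MarkovChainSpace A → ℂ, Measurable φ ∧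
      ∀ g : Lp ℂ 2 m, (π a g : X → ℂ) =ᵐ[m] fun x => φ (θ x) * g x := by
  -- The generators are selfadjoint, so that no adjoints need to be considered.
  have hstar : star (Set.range fun I : List (Fin n) => word A I * star (word A I)) ⊆
      Set.range fun I : List (Fin n) => word A I * star (word A I) := by
    rintro b ⟨I, hI⟩
    exact ⟨I, by rw [← star_star b, ← hI]; simp⟩
  rw [← StarSubalgebra.mem_toSubalgebra, StarAlgebra.adjoin_toSubalgebra,
    Set.union_eq_left.2 hstar] at ha
  induction ha using Algebra.adjoin_induction with
  | mem a ha =>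
    obtain ⟨I, rfl⟩ := ha
    refine ⟨((markovBranchingMaps A).wordCylinder I).indicator 1, measurable_one.indicator
      (measurableSet_wordCylinder_markov I), fun g => ?_⟩
    filter_upwards [hπ.word_mul_star_word hF hf I g, hθ.mem_wordCylinder_iff hF I] with x h1 h2
    by_cases hx : x ∈ F.wordCylinder I
    · rw [h1]
      simp [hx, h2.1 hx]
    · rw [h1]
      simp [hx, mt h2.2 hx]
  | algebraMap c =>
    refine ⟨fun _ => c, measurable_const, fun g => ?_⟩
    rw [AlgHomClass.commutes, Algebra.algebraMap_eq_smul_one]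
    exact Lp.coeFn_smul c g
  | add a b _ _ iha ihb =>
    obtain ⟨φ, hφ, hφ'⟩ := iha
    obtain ⟨ψ, hψ, hψ'⟩ := ihb
    refine ⟨φ + ψ, hφ.add hψ, fun g => ?_⟩
    rw [map_add]
    filter_upwards [hφ' g, hψ' g, Lp.coeFn_add (π a g) (π b g)] with x h1 h2 h3
    rw [add_apply, h3, Pi.add_apply, Pi.add_apply, h1, h2, add_mul]
  | mul a b _ _ iha ihb =>
    obtain ⟨φ, hφ, hφ'⟩ := iha
    obtain ⟨ψ, hψ, hψ'⟩ := ihb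
    refine ⟨φ * ψ, hφ.mul hψ, fun g => ?_⟩
    rw [map_mul]
    filter_upwards [hφ' (π b g), hψ' g] with x h1 h2
    rw [mul_apply_eq_comp, h1, h2, Pi.mul_apply, mul_assoc]

/-- If `ξ` is cyclic for the diagonal, then every element of `L²(X, m)` is an almost everywhere
limit of functions `(φ ∘ θ) · ξ`. -/
theorem BranchingMaps.IsAssociatedRep.exists_seq_tendsto (hF : F.IsSemibranching m)
    (hf : F.IsMonicSystem m f) (hπ : F.IsAssociatedRep m f π) (hθ : IsItineraryMap F m θ)
    {ξ : Lp ℂ 2 m} (hξ : Dense {v : Lp ℂ 2 m | ∃ a ∈ diagonal A, v = π a ξ}) (g : Lp ℂ 2 m) :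
    ∃ φ : ℕ → MarkovChainSpace A → ℂ, (∀ k, Measurable (φ k)) ∧
      ∀ᵐ x ∂m, Tendsto (fun k => φ k (θ x) * ξ x) atTop (𝓝 (g x)) := by
  set S := StarAlgebra.adjoin ℂ (Set.range fun I : List (Fin n) => word A I * star (word A I))
  have hcont : Continuous fun a => π a ξ :=
    (ContinuousLinearMap.apply ℂ (Lp ℂ 2 m) ξ).continuous.comp (map_continuous π)
  have hsub : {v : Lp ℂ 2 m | ∃ a ∈ diagonal A, v = π a ξ} ⊆
      closure ((fun a => π a ξ) '' (S : Set (CuntzKriegerAlgebra A))) := by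
    rintro v ⟨a, ha, rfl⟩
    exact image_closure_subset_closure_image hcont ⟨a, ha, rfl⟩
  have hg : g ∈ closure ((fun a => π a ξ) '' (S : Set (CuntzKriegerAlgebra A))) :=
    closure_minimal hsub isClosed_closure (hξ g)
  obtain ⟨u, hu, hug⟩ := mem_closure_iff_seq_limit.1 hg
  obtain ⟨ns, -, hns⟩ := (tendstoInMeasure_of_tendsto_Lp hug).exists_seq_tendsto_ae
  choose a ha hau using hu
  choose φ hφ hφ' using fun k => hπ.exists_multiplier hF hf hθ (ha k)
  refine ⟨fun k => φ (ns k), fun k => hφ _, ?_⟩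
  filter_upwards [hns, ae_all_iff.2 fun k => hφ' k ξ] with x h1 h2
  refine h1.congr fun k => ?_
  rw [← h2 (ns k), ← hau]

/-- If the diagonal has a cyclic vector `ξ`, then every element of `L²(X, m)` is a function of the
itinerary. Indeed each is of the form `(ψ ∘ θ) · ξ`, and so is the constant function `1`; hence `ξ`
vanishes almost nowhere and is itself a function of the itinerary. -/
theorem BranchingMaps.IsAssociatedRep.exists_ae_eq_comp (hF : F.IsSemibranching m)
    (hf : F.IsMonicSystem m f) (hπ : F.IsAssociatedRep m f π) (hθ : IsItineraryMap F m θ)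
    (hmon : IsMonicRep π) (g : Lp ℂ 2 m) :
    ∃ ψ : MarkovChainSpace A → ℂ, Measurable ψ ∧ (g : X → ℂ) =ᵐ[m] ψ ∘ θ := by
  have := hF.isProbabilityMeasure
  obtain ⟨ξ, hξ⟩ := hmon
  have hone := Lp.coeFn_const 2 m (1 : ℂ)
  have hξ0 : ∀ᵐ x ∂m, ξ x ≠ 0 := by
    obtain ⟨φ, -, hφ⟩ := hπ.exists_seq_tendsto hF hf hθ hξ (Lp.const 2 m (1 : ℂ))
    filter_upwards [hφ, hone] with x h1 h2 h3
    rw [h2] at h1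
    simp [h3] at h1
  have key : ∀ g : Lp ℂ 2 m, ∃ ψ : MarkovChainSpace A → ℂ, Measurable ψ ∧
      ∀ᵐ x ∂m, g x = ψ (θ x) * ξ x := by
    intro g
    obtain ⟨φ, hφ, hφg⟩ := hπ.exists_seq_tendsto hF hf hθ hξ g
    have hlim : ∀ᵐ x ∂m, Tendsto (fun k => φ k (θ x)) atTop (𝓝 (g x / ξ x)) := by
      filter_upwards [hφg, hξ0] with x h1 h2
      simpa [h2] using h1.div_const (ξ x)
    obtain ⟨ψ, hψ, hψ'⟩ := measurable_limit_of_tendsto_metrizable_ae (μ := m.map θ) (L := atTop)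
      (fun k => (hφ k).aemeasurable) ((ae_map_iff hθ.measurable.aemeasurable
        (measurableSet_exists_tendsto hφ)).2 (hlim.mono fun x hx => ⟨_, hx⟩))
    refine ⟨ψ, hψ, ?_⟩
    filter_upwards [ae_of_ae_map hθ.measurable.aemeasurable hψ', hlim, hξ0] with x h1 h2 h3
    rw [tendsto_nhds_unique h1 h2, div_mul_cancel₀ _ h3]
  obtain ⟨ψ, hψ, hψg⟩ := key g
  obtain ⟨ψ₁, hψ₁, hψ₁1⟩ := key (Lp.const 2 m (1 : ℂ))
  refine ⟨fun y => ψ y / ψ₁ y, hψ.div hψ₁, ?_⟩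
  filter_upwards [hψg, hψ₁1, hone] with x h1 h2 h3
  rw [h3, Function.const_apply] at h2
  have h4 : ψ₁ (θ x) ≠ 0 := fun h => by simp [h] at h2
  rw [h1, Function.comp_apply, eq_div_iff h4, mul_assoc, mul_comm (ξ x), ← h2, mul_one]

end Factor

/-! ### The monic system induced on the itinerary space -/

section Induced

open BranchingMaps

theorem MeasureTheory.Measure.map_withDensity_comp {α β : Type*} [MeasurableSpace α]
    [MeasurableSpace β] {μ : Measure α} {g : α → β} (hg : Measurable g) {φ : β → ℝ≥0∞}
    (hφ : Measurable φ) : (μ.withDensity (φ ∘ g)).map g = (μ.map g).withDensity φ := by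
  ext s hs
  rw [Measure.map_apply hg hs, withDensity_apply _ (hg hs), withDensity_apply _ hs,
    setLIntegral_map hs hφ hg]
  rfl

/-- If both `m ∘ σ_i ≪ m` and `m ∘ σ_i⁻¹ ≪ m`, then the density of `m ∘ σ_i` is positive almost
everywhere on `D_i`: its zero set in `D_i` has a null image under `σ_i`, hence is itself null. -/
theorem BranchingMaps.ae_rnDeriv_compBranch_pos {ι X : Type*} [MeasurableSpace X]
    {F : BranchingMaps ι X} {m : Measure X} [IsFiniteMeasure m] {i : ι}
    (hD : MeasurableSet (F.dom i)) (he : MeasurableEmbedding (F.branch i))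
    (hac : F.compBranch m i ≪ m) (hac' : F.compBranchInv m i ≪ m) :
    ∀ᵐ x ∂m, x ∈ F.dom i → 0 < (F.compBranch m i).rnDeriv m x := by
  set Z : Set X := {x | (F.compBranch m i).rnDeriv m x = 0}
  have hZ : MeasurableSet Z := Measure.measurable_rnDeriv _ _ (measurableSet_singleton 0)
  have h0 : F.compBranch m i Z = 0 := by
    rw [← Measure.withDensity_rnDeriv_eq _ _ hac, withDensity_apply _ hZ,
      setLIntegral_congr_fun hZ (g := fun _ => 0) fun x hx => hx, lintegral_zero]
  rw [compBranch_apply he hZ] at h0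
  have h1 := hac' h0
  rw [compBranchInv_apply hD he
    (he.measurableSet_image.2 (measurable_subtype_coe hZ)), Set.preimage_image_eq _ he.injective]
    at h1
  filter_upwards [measure_eq_zero_iff_ae_notMem.1 h1] with x hx hxD
  exact pos_iff_ne_zero.2 fun h => hx ⟨⟨x, hxD⟩, h, rfl⟩

variable {n : ℕ} {A : Matrix (Fin n) (Fin n) ℤ}

theorem measurableSet_markov_dom (i : Fin n) : MeasurableSet ((markovBranchingMaps A).dom i) :=
  measurable_markovChain_apply 0 (MeasurableSet.of_discrete (s := {j | A i j = 1}))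

theorem measurableEmbedding_markov_branch (i : Fin n) :
    MeasurableEmbedding ((markovBranchingMaps A).branch i) where
  injective x y h := Subtype.ext (congrArg (markovBranchingMaps A).coding h)
  measurable := by
    refine (measurable_pi_lambda _ fun k => ?_).subtype_mk
    cases k with
    | zero => exact measurable_const
    | succ k => exact (measurable_markovChain_apply k).comp measurable_subtype_coe
  measurableSet_image' s hs := by
    have : (markovBranchingMaps A).branch i '' s = (markovBranchingMaps A).ran i ∩
        (markovBranchingMaps A).coding ⁻¹' (Subtype.val '' s) := by
      ext x
      constructor
      · rintro ⟨y, hy, rfl⟩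
        exact ⟨⟨y, rfl⟩, y, hy, rfl⟩
      · rintro ⟨⟨y, rfl⟩, z, hz, hzy⟩
        obtain rfl : z = y := Subtype.ext hzy
        exact ⟨z, hz, rfl⟩
    rw [this, ran_markovBranchingMaps]
    exact (measurable_markovChain_apply 0 (MeasurableSet.singleton i)).inter
      (measurable_markov_coding
        ((MeasurableEmbedding.subtype_coe (measurableSet_markov_dom i)).measurableSet_image.2 hs))

variable {X : Type*} [MeasurableSpace X] {F : BranchingMaps (Fin n) X} {m : Measure X}
  {f : Fin n → X → ℂ} {θ : X → MarkovChainSpace A}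

theorem BranchingMaps.IsItineraryMap.compBranchInv_map (hF : F.IsSemibranching m)
    (hCK : F.SatisfiesCK m A) (hθ : IsItineraryMap F m θ) {i : Fin n}
    (hac : F.compBranchInv m i ≪ m) :
    (markovBranchingMaps A).compBranchInv (m.map θ) i = (F.compBranchInv m i).map θ := by
  ext E hE
  have hD := measurableSet_markov_dom (A := A) i
  have he := measurableEmbedding_markov_branch (A := A) i
  rw [compBranchInv_apply hD he hE, Measure.map_apply hθ.measurable hE,
    compBranchInv_apply (hF.measurableSet_dom i) (hF.measurableEmbedding i) (hθ.measurable hE),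
    Measure.map_apply hθ.measurable
      ((MeasurableEmbedding.subtype_coe hD).measurableSet_image.2 (he.measurable hE))]
  refine measure_congr (Filter.eventuallyEq_set.2 ?_)
  filter_upwards [hθ.mem_dom_iff hCK i, hθ.apply_branch hF i hac] with x h1 h2
  constructor
  · rintro ⟨⟨y, hy⟩, hyE, rfl : y = θ x⟩
    exact ⟨⟨x, h1.2 hy⟩, by rwa [Set.mem_preimage, Set.mem_preimage, h2 _ hy], rfl⟩
  · rintro ⟨⟨y, hy⟩, hyE, rfl : y = x⟩
    exact ⟨⟨θ y, h1.1 hy⟩, by rwa [Set.mem_preimage, ← h2 hy], rfl⟩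

/-- If all square integrable functions are functions of the itinerary, then the distribution of the
itinerary turns the standard maps into a semibranching function system. -/
theorem BranchingMaps.IsItineraryMap.isSemibranching_map (hF : F.IsSemibranching m)
    (hCK : F.SatisfiesCK m A) (hθ : IsItineraryMap F m θ)
    (hac : ∀ i, F.compBranchInv m i ≪ m)
    (hfactor : ∀ g : Lp ℂ 2 m, ∃ ψ : MarkovChainSpace A → ℂ,
      Measurable ψ ∧ (g : X → ℂ) =ᵐ[m] ψ ∘ θ) :
    (markovBranchingMaps A).IsSemibranching (m.map θ) := by
  have := hF.isProbabilityMeasure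
  have hprob : IsProbabilityMeasure (m.map θ) :=
    Measure.isProbabilityMeasure_map hθ.measurable.aemeasurable
  have hmc := measurable_markov_coding (A := A)
  have hac₁ : ∀ i, (markovBranchingMaps A).compBranch (m.map θ) i ≪ m.map θ := by
    refine fun i => Measure.AbsolutelyContinuous.mk fun E hE hE0 => ?_
    rw [compBranch_apply (measurableEmbedding_markov_branch i) hE]
    have hpre : m.map θ ((markovBranchingMaps A).coding ⁻¹' E) = 0 := by
      rw [Measure.map_apply hθ.measurable hE] at hE0
      rw [Measure.map_apply hθ.measurable (hmc hE), measure_eq_zero_iff_ae_notMem]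
      filter_upwards [hF.quasiMeasurePreserving_coding.ae
        (measure_eq_zero_iff_ae_notMem.1 hE0), hθ.apply_coding] with x h1 h2
      rwa [Set.mem_preimage, Set.mem_preimage, ← h2]
    refine measure_mono_null ?_ hpre
    rintro _ ⟨y, hy, rfl⟩
    exact hy
  have hac₂ : ∀ i, (markovBranchingMaps A).compBranchInv (m.map θ) i ≪ m.map θ := fun i => by
    rw [hθ.compBranchInv_map hF hCK (hac i)]
    exact (hac i).map hθ.measurable
  refine
    { isProbabilityMeasure := hprob
      nonatomic := fun s hs hs0 => ?_
      measurableSet_dom := measurableSet_markov_dom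
      measurableEmbedding := measurableEmbedding_markov_branch
      ran_inter := fun i j hij => ?_
      ran_cover := ?_
      absolutelyContinuous := hac₁
      rnDeriv_pos := fun i => ae_rnDeriv_compBranch_pos (measurableSet_markov_dom i)
        (measurableEmbedding_markov_branch i) (hac₁ i) (hac₂ i)
      measurable_coding := hmc
      coding_branch := fun i => ae_of_all _ fun x hx => rfl }
  -- A subset of `θ⁻¹ s` of intermediate measure agrees almost everywhere with the preimage of a
  -- Borel set, since its indicator function is a function of the itinerary.
  · rw [Measure.map_apply hθ.measurable hs] at hs0 ⊢
    obtain ⟨t, hts, ht, ht0, hlt⟩ := hF.nonatomic _ (hθ.measurable hs) hs0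
    obtain ⟨ψ, hψ, hψt⟩ := hfactor (indicatorConstLp 2 ht (measure_ne_top m t) 1)
    have hB : MeasurableSet (s ∩ ψ ⁻¹' {1}) := hs.inter (hψ (measurableSet_singleton 1))
    have heq : m (θ ⁻¹' (s ∩ ψ ⁻¹' {1})) = m t := by
      refine measure_congr (Filter.eventuallyEq_set.2 ?_)
      filter_upwards [hψt, indicatorConstLp_coeFn (hs := ht) (hμs := measure_ne_top m t) (p := 2)
        (c := (1 : ℂ))] with x h1 h2
      rw [h1, Function.comp_apply] at h2
      by_cases hx : x ∈ t
      · rw [Set.indicator_of_mem hx] at h2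
        exact iff_of_true ⟨hts hx, h2⟩ hx
      · rw [Set.indicator_of_notMem hx] at h2
        exact iff_of_false (fun h => zero_ne_one (h2.symm.trans h.2)) hx
    refine ⟨s ∩ ψ ⁻¹' {1}, Set.inter_subset_left, hB, ?_, ?_⟩
    · rwa [Measure.map_apply hθ.measurable hB, heq]
    · rwa [Measure.map_apply hθ.measurable hB, heq]
  · convert measure_empty (μ := m.map θ)
    rw [ran_markovBranchingMaps, ran_markovBranchingMaps, Set.eq_empty_iff_forall_notMem]
    rintro x ⟨hi, hj⟩
    exact hij (hi.symm.trans hj)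
  · convert measure_empty (μ := m.map θ)
    rw [Set.compl_empty_iff, Set.eq_univ_iff_forall]
    intro x
    rw [Set.mem_iUnion]
    exact ⟨x.1 0, by rw [ran_markovBranchingMaps]; rfl⟩

theorem BranchingMaps.IsItineraryMap.isMonicSystem_map (hF : F.IsSemibranching m)
    (hCK : F.SatisfiesCK m A) (hθ : IsItineraryMap F m θ) (hf : F.IsMonicSystem m f)
    {h : Fin n → MarkovChainSpace A → ℂ} (hh : ∀ i, Measurable (h i))
    (hfh : ∀ i, f i =ᵐ[m] h i ∘ θ) :
    (markovBranchingMaps A).IsMonicSystem (m.map θ) h := by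
  have := hF.isProbabilityMeasure
  have hmeas : ∀ i, Measurable fun y => ENNReal.ofReal (‖h i y‖ ^ 2) := fun i =>
    ((hh i).norm.pow_const 2).ennreal_ofReal
  have hdens : ∀ i, (markovBranchingMaps A).compBranchInv (m.map θ) i =
      (m.map θ).withDensity fun y => ENNReal.ofReal (‖h i y‖ ^ 2) := by
    intro i
    rw [hθ.compBranchInv_map hF hCK (hf.absolutelyContinuous i), hf.compBranchInv_eq hF,
      ← Measure.map_withDensity_comp hθ.measurable (hmeas i)]
    congr 1
    refine withDensity_congr_ae ?_
    filter_upwards [hfh i] with x hx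
    rw [hx]
    rfl
  refine ⟨fun i => ?_, fun i => ?_, fun i => ?_, fun i => ?_⟩
  · rw [hdens]
    exact withDensity_absolutelyContinuous _ _
  · rw [memLp_map_measure_iff (hh i).aestronglyMeasurable hθ.measurable.aemeasurable]
    exact (hf.memLp i).ae_eq (hfh i)
  · rw [hdens]
    exact Measure.rnDeriv_withDensity _ (hmeas i)
  · rw [ae_map_iff hθ.measurable.aemeasurable, ran_markovBranchingMaps]
    · filter_upwards [hf.ne_zero i, hfh i, hθ.mem_ran_iff] with x h1 h2 h3 hx
      have h4 := h1 ((h3 i).2 hx)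
      rwa [h2] at h4
    · rw [ran_markovBranchingMaps]
      have h1 : MeasurableSet {x : MarkovChainSpace A | x.1 0 = i} :=
        measurable_markovChain_apply 0 (MeasurableSet.singleton i)
      have h2 : MeasurableSet {x | h i x ≠ 0} := (hh i (measurableSet_singleton 0)).compl
      exact h1.imp h2

end Induced

theorem mainTheorem2 {n : ℕ} (A : Matrix (Fin n) (Fin n) ℤ)
    (hA01 : ∀ i j, A i j = 0 ∨ A i j = 1) (hA : A.IsPrimitive)
    {X : Type*} [MeasurableSpace X] (m : Measure X) (F : BranchingMaps (Fin n) X)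
    (hF : F.IsSemibranching m) (hsat : F.IsSaturated m) (hCK : F.SatisfiesCK m A)
    (f : Fin n → X → ℂ) (hf : F.IsMonicSystem m f)
    (π : CuntzKriegerAlgebra A →⋆ₐ[ℂ] (Lp ℂ 2 m →L[ℂ] Lp ℂ 2 m))
    (hπ : F.IsAssociatedRep m f π) :
    IsMonicRep π ↔
      ∃ (μ : Measure (MarkovChainSpace A)) (h : Fin n → MarkovChainSpace A → ℂ)
        (ρ : CuntzKriegerAlgebra A →⋆ₐ[ℂ] (Lp ℂ 2 μ →L[ℂ] Lp ℂ 2 μ)),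
        IsInherentMonicSystem A μ h ∧ (markovBranchingMaps A).IsAssociatedRep μ h ρ ∧
          UnitarilyEquivalentReps π ρ := by
  refine ⟨fun hmon => ?_, fun ⟨μ, h, ρ, hh, hρ, hU⟩ =>
    (isMonicRep_of_inherent hh hρ).of_unitarilyEquivalent hU⟩
  obtain ⟨θ, hθ⟩ := hF.exists_isItineraryMap hCK
  -- Composition with the itinerary map `θ` is unitary from `L²(X_A, θ_* m)` onto `L²(X, m)`, and
  -- `f_i = h_i ∘ θ`. Conjugation by it turns `f_i · (g ∘ σ)` into `h_i · (g ∘ shift)`.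
  have hfactor := hπ.exists_ae_eq_comp hF hf hθ hmon
  choose h hh hfh' using fun i => hfactor ((hf.memLp i).toLp (f i))
  have hfh : ∀ i, f i =ᵐ[m] h i ∘ θ := fun i => (hf.memLp i).coeFn_toLp.symm.trans (hfh' i)
  have hmp : MeasurePreserving θ m (m.map θ) := hθ.measurable.measurePreserving m
  let V := Lp.compMeasurePreservingₗᵢ ℂ (E := ℂ) (p := 2) θ hmp
  have hV : ∀ g : Lp ℂ 2 (m.map θ), (V g : X → ℂ) =ᵐ[m] g ∘ θ := fun g =>
    Lp.coeFn_compMeasurePreserving g hmp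
  have hVsurj : Function.Surjective V := by
    intro g
    obtain ⟨ψ, hψ, hψg⟩ := hfactor g
    have hψL : MemLp ψ 2 (m.map θ) := by
      rw [memLp_map_measure_iff hψ.aestronglyMeasurable hθ.measurable.aemeasurable]
      exact (Lp.memLp g).ae_eq hψg
    exact ⟨hψL.toLp ψ, Lp.ext ((hV _).trans
      ((hmp.quasiMeasurePreserving.ae_eq_comp hψL.coeFn_toLp).trans hψg.symm))⟩
  let U := (LinearIsometryEquiv.ofSurjective V hVsurj).symm
  have hUV : ∀ g, V (U g) = g := (LinearIsometryEquiv.ofSurjective V hVsurj).apply_symm_apply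
  let ρ : CuntzKriegerAlgebra A →⋆ₐ[ℂ] (Lp ℂ 2 (m.map θ) →L[ℂ] Lp ℂ 2 (m.map θ)) :=
    (U.conjStarAlgEquiv : (Lp ℂ 2 m →L[ℂ] Lp ℂ 2 m) →⋆ₐ[ℂ] _).comp π
  refine ⟨m.map θ, h, ρ,
    ⟨hθ.isSemibranching_map hF hCK hf.absolutelyContinuous hfactor,
      hθ.isMonicSystem_map hF hCK hf hh hfh⟩, fun i g => ?_, U, fun a v => ?_⟩
  · set χ := ρ (CuntzKriegerAlgebra.gen A i) g
    have hχ : V χ = π (CuntzKriegerAlgebra.gen A i) (V g) := hUV _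
    have hmeas : MeasurableSet {y | χ y = h i y * g ((markovBranchingMaps A).coding y)} :=
      measurableSet_eq_fun (Lp.stronglyMeasurable χ).measurable
        ((hh i).mul ((Lp.stronglyMeasurable g).measurable.comp measurable_markov_coding))
    refine (ae_map_iff hθ.measurable.aemeasurable hmeas).2 ?_
    filter_upwards [hV χ, hπ i (V g), hF.quasiMeasurePreserving_coding.ae_eq_comp (hV g),
      hfh i, hθ.apply_coding] with x h1 h2 h3 h4 h5
    simp only [Function.comp_apply] at h1 h3 h4
    rw [← h1, hχ, h2, h3, h4, h5]
  · change U (π a v) = U (π a (U.symm (U v)))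
    rw [U.symm_apply_apply]
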